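/- Let $n\ge 2$ and let $I\subseteq\mathbb R$ be an interval (open or not, bounded or not) with more than one point; derivatives at end points belonging to $I$ are one-sided. A curve is a smooth map $f:I\to\mathbb R^n$ that is $(n-1)$-regular, i.e. $f'(t),\dots,f^{(n-1)}(t)$ are linearly independent for every $t\in I$. Its speed is $\nu_f=\|f'\|$. Its Frenet frame $V_1,\dots,V_n$ is the positively oriented orthonormal frame along $f$ in which $V_1,\dots,V_{n-1}$ are obtained from $f',\dots,f^{(n-1)}$ by the Gram–Schmidt process and $V_n=V_1\times\cdots\times V_{n-1}$ (that is, $V_n\cdot X=\det(V_1,\dots,V_{n-1},X)$ for all $X\in\mathbb R^n$). Its curvatures are the functions $\kappa_j=\dfrac{V_j'\cdot V_{j+1}}{\nu_f}$, $1\le j\le n-1$, i.e. the coefficients in the Frenet equations $V_j'=-\kappa_{j-1}\nu_f V_{j-1}+\kappa_j\nu_f V_{j+1}$ (where the terms with $V_0$ and $V_{n+1}$ are absent). **Theorem.** Let $\nu$ and $k_1,\dots,k_{n-1}$ be smooth real functions on $I$ such that $\nu(t)>0$ and $k_j(t)>0$ for all $t\in I$ and $1\le j\le n-2$. Then there exists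 a curve $f:I\to\mathbb R^n$ with speed $\nu$ and curvatures $k_1,\dots,k_{n-1}$. Furthermore, if $f,g:I\to\mathbb R^n$ are any two curves with speed $\nu$ and curvatures $k_1,\dots,k_{n-1}$, then there exists an orientation-preserving isometry $F$ of $\mathbb R^n$ (i.e. $F(X)=SX+X_0$ with $S$ orthogonal and $\det S=1$) such that $g=F\circ f$. -/

import Mathlib

open scoped ContDiff

noncomputable section

namespace FrenetCurve

/-- The cross product `w 1 × ⋯ × w (n-1)` of `n - 1` vectors of `ℝⁿ` (only the entries
`w 1, …, w (n-1)` of the sequence are used): the vector whose inner product with any `X` is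
`det (w 1, …, w (n-1), X)`, the arguments being the columns. Its `i`-th coordinate is therefore
the determinant with the `i`-th standard basis vector in the last column. -/
def cross {n : ℕ} (w : ℕ → EuclideanSpace ℝ (Fin n)) : EuclideanSpace ℝ (Fin n) :=
  WithLp.toLp 2 fun i : Fin n =>
    Matrix.det (Matrix.of fun r c : Fin n =>
      if (c : ℕ) + 1 = n then (if r = i then (1 : ℝ) else 0) else w ((c : ℕ) + 1) r)

/-- The speed `ν(t) = ‖f'(t)‖` of a curve `f` on the interval `I`. Derivatives are taken within
`I`, hence are one-sided at end points that belong to `I`. -/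
def speed {n : ℕ} (I : Set ℝ) (f : ℝ → EuclideanSpace ℝ (Fin n)) (t : ℝ) : ℝ :=
  ‖derivWithin f I t‖

/-- The orthonormalization of `f'(t), f''(t), f'''(t), …` by the Gram-Schmidt process, numbered
from `1`. -/
def gramSchmidtFrame {n : ℕ} (I : Set ℝ) (f : ℝ → EuclideanSpace ℝ (Fin n)) (j : ℕ) (t : ℝ) :
    EuclideanSpace ℝ (Fin n) :=
  InnerProductSpace.gramSchmidtNormed ℝ (fun i : ℕ => iteratedDerivWithin (i + 1) f I t) (j - 1)

/-- The Frenet frame `V_1, …, V_n` of an `(n-1)`-regular curve in `ℝⁿ`, numbered from `1`: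
`V_1, …, V_{n-1}` arise from `f', …, f^{(n-1)}` by the Gram-Schmidt process, and
`V_n = V_1 × ⋯ × V_{n-1}`. -/
def frenetFrame {n : ℕ} (I : Set ℝ) (f : ℝ → EuclideanSpace ℝ (Fin n)) (j : ℕ) (t : ℝ) :
    EuclideanSpace ℝ (Fin n) :=
  if j = n then cross fun i => gramSchmidtFrame I f i t else gramSchmidtFrame I f j t

/-- The curvatures `κ_1, …, κ_{n-1}`: the coefficients in the Frenet equations
`V_j' = - κ_{j-1} ν V_{j-1} + κ_j ν V_{j+1}`, that is, `κ_j = (V_j' ⬝ V_{j+1}) / ν`. -/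
def curvature {n : ℕ} (I : Set ℝ) (f : ℝ → EuclideanSpace ℝ (Fin n)) (j : ℕ) (t : ℝ) : ℝ :=
  inner ℝ (derivWithin (fun s => frenetFrame I f j s) I t) (frenetFrame I f (j + 1) t) /
    speed I f t

/-- `f` is a smooth `m`-regular curve on `I`: the derivatives `f', …, f^{(m)}` are linearly
independent at each point of `I`. -/
def IsRegularCurve {n : ℕ} (m : ℕ) (I : Set ℝ) (f : ℝ → EuclideanSpace ℝ (Fin n)) : Prop :=
  ContDiffOn ℝ ∞ f I ∧
    ∀ t ∈ I, LinearIndependent ℝ fun i : Fin m => iteratedDerivWithin ((i : ℕ) + 1) f I t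

/-- `f` is a smooth `(n-1)`-regular curve in `ℝⁿ`, defined on `I`, with speed `ν` and curvatures
`k 1, …, k (n-1)`. -/
def HasSpeedAndCurvatures {n : ℕ} (I : Set ℝ) (f : ℝ → EuclideanSpace ℝ (Fin n))
    (ν : ℝ → ℝ) (k : ℕ → ℝ → ℝ) : Prop :=
  IsRegularCurve (n - 1) I f ∧ (∀ t ∈ I, speed I f t = ν t) ∧
    ∀ j : ℕ, 1 ≤ j → j ≤ n - 1 → ∀ t ∈ I, curvature I f j t = k j t

/-- An isometry of `ℝⁿ` is orientation preserving if its linear part has determinant `1`. -/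
def OrientationPreserving {n : ℕ}
    (F : EuclideanSpace ℝ (Fin n) ≃ᵃⁱ[ℝ] EuclideanSpace ℝ (Fin n)) : Prop :=
  LinearMap.det
    (F.linearIsometryEquiv.toLinearEquiv :
      EuclideanSpace ℝ (Fin n) →ₗ[ℝ] EuclideanSpace ℝ (Fin n)) = 1

end FrenetCurve

end

/-!
Write `V_1, …, V_n` for the Frenet frame. The Frenet equations form a linear system `V' = K V` whose
coefficient matrix `K` is skew-symmetric and depends only on the speed and the curvatures
(`frenetMatrix`). Hence the theorem is about the solutions of such systems, on an interval `I` that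
may be open, closed or unbounded.

Two facts about a skew-symmetric system carry the proof. The dot product of two solutions of
`x' = K x` is constant (`sum_mul_eq_of_skew`). Applied to the coordinates of a frame, this says that
`Mᵀ M` is constant for the matrix `M` with rows `V_i`, so a frame that is orthonormal at one time
stays orthonormal; its determinant stays `1` by continuity. It also gives uniqueness, since the
difference of two solutions has constant norm. The second fact is global solvability on `I`
(`exists_hasDerivWithinAt_of_skew`). There the Picard-Lindelöf theorem is applied to a field that is
cut off outside a large ball; norms are conserved, so the solution never meets the cutoff, and the
solutions on compact subintervals are glued by uniqueness.

*Rigidity.* The frame of a regular curve satisfies the Frenet equations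
(`HasSpeedAndCurvatures.solvesFrameSystem`). If `f` and `g` have the same speed and curvatures, the
rotation `S` that takes the frame of `f` to that of `g` at one time does so at all times, by
uniqueness. As `f' = ν V_1`, the curve `g - S ∘ f` has derivative `0`.

*Existence.* Solve the system with the standard basis as initial frame and let `f` be a primitive of
`ν X_1`, where `X` is the solution. Differentiation of the relations `⟪f^{(m)}, X_l⟫ = 0`, `l > m`,
shows inductively that the derivatives of `f` up to order `n - 1` have a triangular matrix in the
frame `X`, with diagonal entries `ν^m k_1 ⋯ k_{m-1} > 0` (`inner_iteratedDerivWithin_frame`). So `f`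
is regular, the Gram-Schmidt process returns `X_1, …, X_{n-1}`, the cross product of these is `X_n`
because `X` is positively oriented, and the curvatures are read off from the system.
-/

namespace FrenetCurve

open Set Metric
open scoped NNReal Topology

/-! ### Ordinary differential equations on an arbitrary interval -/

lemma eq_of_hasDerivWithinAt_zero {F : Type*} [NormedAddCommGroup F] [NormedSpace ℝ F]
    {I : Set ℝ} (hI : I.OrdConnected) {f : ℝ → F}
    (hf : ∀ t ∈ I, HasDerivWithinAt f 0 I t) {s t : ℝ} (hs : s ∈ I) (ht : t ∈ I) :
    f s = f t := by
  have := hI.convex.norm_image_sub_le_of_norm_hasDerivWithin_le (C := 0) hf (by simp) ht hs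
  simpa [sub_eq_zero] using this

/-- Together with `exists_Iic_mem_nhdsWithin`, this gives for each `t ∈ I` a compact subinterval of
`I` that contains `t₀` and is a neighbourhood of `t` within `I`, also if `t` is an end point. -/
lemma exists_Ici_mem_nhdsWithin {I : Set ℝ} {t₀ t : ℝ} (ht₀ : t₀ ∈ I) (ht : t ∈ I) :
    ∃ a ∈ I, a ≤ t₀ ∧ a ≤ t ∧ Ici a ∈ 𝓝[I] t := by
  by_cases h : ∃ c ∈ I, c < t
  · obtain ⟨c, hc, hct⟩ := h
    refine ⟨min c t₀, by rcases min_choice c t₀ with h | h <;> rw [h] <;> assumption,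
      min_le_right _ _, (min_le_left _ _).trans hct.le, ?_⟩
    exact mem_nhdsWithin_of_mem_nhds (Ici_mem_nhds (min_lt_of_left_lt hct))
  · push Not at h
    refine ⟨min t t₀, by rcases min_choice t t₀ with h | h <;> rw [h] <;> assumption,
      min_le_right _ _, min_le_left _ _, ?_⟩
    exact Filter.mem_of_superset self_mem_nhdsWithin
      fun s hs => (min_le_left _ _).trans (h s hs)

lemma exists_Iic_mem_nhdsWithin {I : Set ℝ} {t₀ t : ℝ} (ht₀ : t₀ ∈ I) (ht : t ∈ I) :
    ∃ b ∈ I, t₀ ≤ b ∧ t ≤ b ∧ Iic b ∈ 𝓝[I] t := by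
  by_cases h : ∃ c ∈ I, t < c
  · obtain ⟨c, hc, hct⟩ := h
    refine ⟨max c t₀, by rcases max_choice c t₀ with h | h <;> rw [h] <;> assumption,
      le_max_right _ _, hct.le.trans (le_max_left _ _), ?_⟩
    exact mem_nhdsWithin_of_mem_nhds (Iic_mem_nhds (lt_max_of_lt_left hct))
  · push Not at h
    refine ⟨max t t₀, by rcases max_choice t t₀ with h | h <;> rw [h] <;> assumption,
      le_max_right _ _, le_max_left _ _, ?_⟩
    exact Filter.mem_of_superset self_mem_nhdsWithin
      fun s hs => (h s hs).trans (le_max_left _ _)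

/-- Uniqueness for an initial value problem on a compact interval, where the initial time may be an
end point. -/
lemma eqOn_Icc_of_hasDerivWithinAt {F : Type*} [NormedAddCommGroup F] [NormedSpace ℝ F]
    {v : ℝ → F → F} {a b t₀ : ℝ} {K : ℝ≥0} (hv : ∀ t ∈ Icc a b, LipschitzWith K (v t))
    (ht₀ : t₀ ∈ Icc a b) {x y : ℝ → F}
    (hx : ∀ t ∈ Icc a b, HasDerivWithinAt x (v t (x t)) (Icc a b) t)
    (hy : ∀ t ∈ Icc a b, HasDerivWithinAt y (v t (y t)) (Icc a b) t) (h : x t₀ = y t₀) :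
    EqOn x y (Icc a b) := by
  -- the derivative within `[a, b]` is a right derivative on `[t₀, b)`, a left one on `(a, t₀]`
  have hright : ∀ z : ℝ → F, (∀ t ∈ Icc a b, HasDerivWithinAt z (v t (z t)) (Icc a b) t) →
      ∀ t ∈ Ico t₀ b, HasDerivWithinAt z (v t (z t)) (Ici t) t := fun z hz t ht =>
    (hz t ⟨ht₀.1.trans ht.1, ht.2.le⟩).mono_of_mem_nhdsWithin
      (Filter.mem_of_superset (Icc_mem_nhdsGE ht.2) (Icc_subset_Icc_left (ht₀.1.trans ht.1)))
  have hleft : ∀ z : ℝ → F, (∀ t ∈ Icc a b, HasDerivWithinAt z (v t (z t)) (Icc a b) t) →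
      ∀ t ∈ Ioc a t₀, HasDerivWithinAt z (v t (z t)) (Iic t) t := fun z hz t ht =>
    (hz t ⟨ht.1.le, ht.2.trans ht₀.2⟩).mono_of_mem_nhdsWithin
      (Filter.mem_of_superset (Icc_mem_nhdsLE ht.1) (Icc_subset_Icc_right (ht.2.trans ht₀.2)))
  have hxc : ContinuousOn x (Icc a b) := fun t ht => (hx t ht).continuousWithinAt
  have hyc : ContinuousOn y (Icc a b) := fun t ht => (hy t ht).continuousWithinAt
  rw [← Icc_union_Icc_eq_Icc ht₀.1 ht₀.2]
  refine EqOn.union ?_ ?_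
  · exact ODE_solution_unique_of_mem_Icc_left (s := fun _ => univ) (K := K) (v := v)
      (fun t ht => (hv t ⟨ht.1.le, ht.2.trans ht₀.2⟩).lipschitzOnWith)
      (hxc.mono (Icc_subset_Icc_right ht₀.2)) (hleft x hx) (fun _ _ => mem_univ _)
      (hyc.mono (Icc_subset_Icc_right ht₀.2)) (hleft y hy) (fun _ _ => mem_univ _) h
  · exact ODE_solution_unique_of_mem_Icc_right (s := fun _ => univ) (K := K) (v := v)
      (fun t ht => (hv t ⟨ht₀.1.trans ht.1, ht.2.le⟩).lipschitzOnWith)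
      (hxc.mono (Icc_subset_Icc_left ht₀.1)) (hright x hx) (fun _ _ => mem_univ _)
      (hyc.mono (Icc_subset_Icc_left ht₀.1)) (hright y hy) (fun _ _ => mem_univ _) h

/-- Global existence on an arbitrary interval `I` for a vector field that is bounded and uniformly
Lipschitz over each compact subinterval. The solution is glued from the Picard-Lindelöf solutions on
the compact subintervals. -/
lemma exists_hasDerivWithinAt_of_lipschitz_of_bounded {F : Type*} [NormedAddCommGroup F]
    [NormedSpace ℝ F] [CompleteSpace F] {I : Set ℝ} (hI : I.OrdConnected) {v : ℝ → F → F}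
    (hcont : ∀ x, ContinuousOn (fun t => v t x) I)
    (hv : ∀ a ∈ I, ∀ b ∈ I, ∃ K L : ℝ≥0, ∀ t ∈ Icc a b, LipschitzWith K (v t) ∧ ∀ x, ‖v t x‖ ≤ L)
    {t₀ : ℝ} (ht₀ : t₀ ∈ I) (x₀ : F) :
    ∃ x : ℝ → F, x t₀ = x₀ ∧ ∀ t ∈ I, HasDerivWithinAt x (v t (x t)) I t := by
  have hex : ∀ a b : ℝ, a ∈ I ∧ b ∈ I ∧ t₀ ∈ Icc a b → ∃ x : ℝ → F, x t₀ = x₀ ∧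
      ∀ t ∈ Icc a b, HasDerivWithinAt x (v t (x t)) (Icc a b) t := by
    rintro a b ⟨ha, hb, h0⟩
    obtain ⟨K, L, hKL⟩ := hv a ha b hb
    -- as the field is bounded by `L` everywhere, any radius `≥ L * (b - a)` will do
    have hPL : IsPicardLindelof v (⟨t₀, h0⟩ : Icc a b) x₀
        (L * (max (b - t₀) (t₀ - a)).toNNReal) 0 L K :=
      { lipschitzOnWith := fun t ht => (hKL t ht).1.lipschitzOnWith
        continuousOn := fun x _ => (hcont x).mono (hI.out ha hb)
        norm_le := fun t ht x _ => (hKL t ht).2 x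
        mul_max_le := by
          rw [NNReal.coe_zero, sub_zero, NNReal.coe_mul]
          exact mul_le_mul_of_nonneg_left (Real.le_coe_toNNReal _) L.2 }
    exact hPL.exists_eq_forall_mem_Icc_hasDerivWithinAt₀
  choose! x hx0 hx using hex
  -- by uniqueness, every solution agrees at `t` with the one on the interval between `t₀` and `t`
  have hglue : ∀ a b : ℝ, a ∈ I ∧ b ∈ I ∧ t₀ ∈ Icc a b → ∀ t ∈ Icc a b,
      x (min t₀ t) (max t₀ t) t = x a b t := by
    rintro a b h t ht
    have hsub : Icc (min t₀ t) (max t₀ t) ⊆ Icc a b :=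
      Icc_subset_Icc (le_min h.2.2.1 ht.1) (max_le h.2.2.2 ht.2)
    have hI' : Icc a b ⊆ I := hI.out h.1 h.2.1
    have hle : min t₀ t ≤ max t₀ t := min_le_max
    have h' : min t₀ t ∈ I ∧ max t₀ t ∈ I ∧ t₀ ∈ Icc (min t₀ t) (max t₀ t) :=
      ⟨hI' (hsub (left_mem_Icc.2 hle)), hI' (hsub (right_mem_Icc.2 hle)),
        min_le_left _ _, le_max_left _ _⟩
    obtain ⟨K, L, hKL⟩ := hv _ h'.1 _ h'.2.1
    exact eqOn_Icc_of_hasDerivWithinAt (fun s hs => (hKL s hs).1) h'.2.2 (hx _ _ h')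
      (fun s hs => (hx a b h s (hsub hs)).mono hsub) ((hx0 _ _ h').trans (hx0 a b h).symm)
      ⟨min_le_right _ _, le_max_right _ _⟩
  refine ⟨fun t => x (min t₀ t) (max t₀ t) t, ?_, fun t ht => ?_⟩
  · simpa using hx0 t₀ t₀ (by simpa using ht₀)
  · obtain ⟨a, ha, ha0, hat, han⟩ := exists_Ici_mem_nhdsWithin ht₀ ht
    obtain ⟨b, hb, hb0, hbt, hbn⟩ := exists_Iic_mem_nhdsWithin ht₀ ht
    have h : a ∈ I ∧ b ∈ I ∧ t₀ ∈ Icc a b := ⟨ha, hb, ha0, hb0⟩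
    have hmem : Icc a b ∈ 𝓝[I] t := Filter.inter_mem han hbn
    have htab : t ∈ Icc a b := ⟨hat, hbt⟩
    simp only [hglue a b h t htab]
    exact ((hx a b h t htab).congr (hglue a b h) (hglue a b h t htab)).mono_of_mem_nhdsWithin hmem

lemma exists_hasDerivWithinAt_of_continuousOn {F : Type*} [NormedAddCommGroup F] [NormedSpace ℝ F]
    [CompleteSpace F] {I : Set ℝ} (hI : I.OrdConnected) (hI' : I.Nonempty) {g : ℝ → F}
    (hg : ContinuousOn g I) : ∃ f : ℝ → F, ∀ t ∈ I, HasDerivWithinAt f (g t) I t := by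
  obtain ⟨t₀, ht₀⟩ := hI'
  obtain ⟨f, -, hf⟩ := exists_hasDerivWithinAt_of_lipschitz_of_bounded hI (v := fun t _ => g t)
    (fun _ => hg) (fun a ha b hb => by
      obtain ⟨C, hC⟩ := isCompact_Icc.exists_bound_of_continuousOn (hg.mono (hI.out ha hb))
      exact ⟨0, C.toNNReal, fun t ht => ⟨LipschitzWith.const _, fun _ =>
        (hC t ht).trans (Real.le_coe_toNNReal C)⟩⟩) ht₀ 0
  exact ⟨f, hf⟩

/-- Global solvability of the linear equation `x' = A(t) x` with skew-symmetric coefficients. The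
field is made bounded by a radial cutoff that equals `1` on a ball around `0` containing the initial
value; since skew-symmetry persists, the norm is conserved, and the solution does not feel the
cutoff. -/
lemma exists_hasDerivWithinAt_of_skew {F : Type*} [NormedAddCommGroup F] [InnerProductSpace ℝ F]
    [FiniteDimensional ℝ F] {I : Set ℝ} (hI : I.OrdConnected) {A : ℝ → F →L[ℝ] F}
    (hA : ContinuousOn A I) (hskew : ∀ t ∈ I, ∀ x, inner ℝ x (A t x) = 0)
    {t₀ : ℝ} (ht₀ : t₀ ∈ I) (x₀ : F) :
    ∃ x : ℝ → F, x t₀ = x₀ ∧ ∀ t ∈ I, HasDerivWithinAt x (A t (x t)) I t := by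
  let φ : ContDiffBump (0 : F) := ⟨‖x₀‖ + 1, ‖x₀‖ + 2, by positivity, by linarith⟩
  let g : F → F := fun x => φ x • x
  have hgsupp : HasCompactSupport g := φ.hasCompactSupport.smul_right
  have hgsmooth : ContDiff ℝ 1 g := φ.contDiff.smul contDiff_id
  obtain ⟨C, hC⟩ := hgsmooth.lipschitzWith_of_hasCompactSupport hgsupp one_ne_zero
  obtain ⟨R, hR⟩ := hgsupp.exists_bound_of_continuous hgsmooth.continuous
  obtain ⟨x, hx0, hx⟩ := exists_hasDerivWithinAt_of_lipschitz_of_bounded hI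
    (v := fun t x => A t (g x)) (fun x => hA.clm_apply continuousOn_const) (fun a ha b hb => by
      obtain ⟨M, hM⟩ := isCompact_Icc.exists_bound_of_continuousOn (hA.mono (hI.out ha hb))
      have hM' : ∀ t ∈ Icc a b, ‖A t‖₊ ≤ M.toNNReal := fun t ht =>
        NNReal.coe_le_coe.1 ((hM t ht).trans (Real.le_coe_toNNReal M))
      refine ⟨M.toNNReal * C, M.toNNReal * R.toNNReal, fun t ht => ⟨?_, fun x => ?_⟩⟩
      · exact ((A t).lipschitz.weaken (hM' t ht)).comp hC
      · rw [NNReal.coe_mul]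
        exact (A t).le_of_opNorm_le_of_le (NNReal.coe_le_coe.2 (hM' t ht))
          ((hR x).trans (Real.le_coe_toNNReal R))) ht₀ x₀
  have hnorm : ∀ t ∈ I, ‖x t‖ = ‖x₀‖ := by
    intro t ht
    have h := eq_of_hasDerivWithinAt_zero hI (f := fun t => ‖x t‖ ^ 2) (fun s hs => by
      have h := (hx s hs).norm_sq
      have h0 : inner ℝ (x s) (A s (g (x s))) = 0 := by
        simp only [g, map_smul, inner_smul_right, hskew s hs, mul_zero]
      rwa [h0, mul_zero] at h) ht ht₀
    simpa [hx0] using h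
  refine ⟨x, hx0, fun t ht => ?_⟩
  have hg : g (x t) = x t := by
    have h1 : φ (x t) = 1 := φ.one_of_mem_closedBall (by
      rw [mem_closedBall_zero_iff, hnorm t ht]
      change ‖x₀‖ ≤ ‖x₀‖ + 1
      linarith)
    simp only [g, h1, one_smul]
  have h := hx t ht
  simp only [hg] at h
  exact h

/-! ### Linear systems for moving frames -/

/-- The family of vector functions `X i` solves `X_i' = ∑ l, K_{i l} X_l` on `I`. -/
def SolvesFrameSystem {n : ℕ} (K : ℝ → Matrix (Fin n) (Fin n) ℝ) (I : Set ℝ)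
    (X : Fin n → ℝ → EuclideanSpace ℝ (Fin n)) : Prop :=
  ∀ i, ∀ t ∈ I, HasDerivWithinAt (X i) (∑ l, K t i l • X l t) I t

/-- The matrix whose rows are the vectors of a family in `ℝⁿ`. -/
def rowMatrix {n : ℕ} (e : Fin n → EuclideanSpace ℝ (Fin n)) : Matrix (Fin n) (Fin n) ℝ :=
  Matrix.of fun i r => e i r

lemma rowMatrix_mul_transpose {n : ℕ} (e : Fin n → EuclideanSpace ℝ (Fin n)) (i j : Fin n) :
    (rowMatrix e * (rowMatrix e).transpose) i j = inner ℝ (e i) (e j) := by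
  simp [rowMatrix, Matrix.mul_apply, PiLp.inner_apply, mul_comm]

lemma orthonormal_iff_rowMatrix {n : ℕ} (e : Fin n → EuclideanSpace ℝ (Fin n)) :
    Orthonormal ℝ e ↔ rowMatrix e * (rowMatrix e).transpose = 1 := by
  rw [orthonormal_iff_ite, ← Matrix.ext_iff]
  simp only [rowMatrix_mul_transpose, Matrix.one_apply]

lemma sq_det_rowMatrix_eq_one {n : ℕ} {e : Fin n → EuclideanSpace ℝ (Fin n)}
    (he : Orthonormal ℝ e) : (rowMatrix e).det ^ 2 = 1 := by
  have h := congrArg Matrix.det ((orthonormal_iff_rowMatrix e).1 he)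
  rwa [Matrix.det_mul, Matrix.det_transpose, Matrix.det_one, ← sq] at h

/-- An orthonormal family of `n` vectors in `ℝⁿ`, as an orthonormal basis. -/
noncomputable def orthonormalBasisOf {n : ℕ} {e : Fin n → EuclideanSpace ℝ (Fin n)}
    (he : Orthonormal ℝ e) : OrthonormalBasis (Fin n) ℝ (EuclideanSpace ℝ (Fin n)) :=
  OrthonormalBasis.mk he
    (he.linearIndependent.span_eq_top_of_card_eq_finrank' (by simp)).ge

@[simp]
lemma orthonormalBasisOf_apply {n : ℕ} {e : Fin n → EuclideanSpace ℝ (Fin n)}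
    (he : Orthonormal ℝ e) (i : Fin n) : orthonormalBasisOf he i = e i := by
  simp [orthonormalBasisOf]

/-- For skew-symmetric coefficients, the dot product of two solutions `x`, `y` of `x' = K x` is
constant. -/
lemma sum_mul_eq_of_skew {n : ℕ} {I : Set ℝ} (hI : I.OrdConnected)
    {K : ℝ → Matrix (Fin n) (Fin n) ℝ} (hK : ∀ t ∈ I, ∀ i l, K t i l = -K t l i)
    {x y : Fin n → ℝ → ℝ}
    (hx : ∀ i, ∀ t ∈ I, HasDerivWithinAt (x i) (∑ l, K t i l * x l t) I t)
    (hy : ∀ i, ∀ t ∈ I, HasDerivWithinAt (y i) (∑ l, K t i l * y l t) I t)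
    {s t : ℝ} (hs : s ∈ I) (ht : t ∈ I) : ∑ i, x i s * y i s = ∑ i, x i t * y i t := by
  refine eq_of_hasDerivWithinAt_zero hI (f := fun t => ∑ i, x i t * y i t) (fun u hu => ?_) hs ht
  have h := HasDerivWithinAt.fun_sum (u := Finset.univ)
    fun i _ => (hx i u hu).fun_mul (hy i u hu)
  convert h using 1
  rw [Finset.sum_add_distrib]
  simp only [Finset.sum_mul, Finset.mul_sum]
  rw [Finset.sum_comm, ← Finset.sum_add_distrib]
  refine (Finset.sum_eq_zero fun i _ => ?_).symm
  rw [← Finset.sum_add_distrib]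
  refine Finset.sum_eq_zero fun l _ => ?_
  rw [hK u hu l i]
  ring

lemma hasDerivWithinAt_euclidean_iff {n : ℕ} {f : ℝ → EuclideanSpace ℝ (Fin n)}
    {f' : EuclideanSpace ℝ (Fin n)} {s : Set ℝ} {t : ℝ} :
    HasDerivWithinAt f f' s t ↔ ∀ r, HasDerivWithinAt (fun u => f u r) (f' r) s t := by
  rw [hasDerivWithinAt_iff_hasFDerivWithinAt, hasFDerivWithinAt_euclidean]
  refine forall_congr' fun r => ?_
  rw [hasDerivWithinAt_iff_hasFDerivWithinAt]
  refine iff_of_eq (congrArg (fun L => HasFDerivWithinAt (fun u => f u r) L s t) ?_)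
  ext
  simp

lemma solvesFrameSystem_iff_coord {n : ℕ} {K : ℝ → Matrix (Fin n) (Fin n) ℝ} {I : Set ℝ}
    {X : Fin n → ℝ → EuclideanSpace ℝ (Fin n)} :
    SolvesFrameSystem K I X ↔ ∀ r i, ∀ t ∈ I,
      HasDerivWithinAt (fun s => X i s r) (∑ l, K t i l * X l t r) I t := by
  simp only [SolvesFrameSystem, hasDerivWithinAt_euclidean_iff, WithLp.ofLp_sum, WithLp.ofLp_smul,
    Finset.sum_apply, Pi.smul_apply, smul_eq_mul]
  exact ⟨fun h r i t ht => h i t ht r, fun h i t ht r => h r i t ht⟩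

lemma SolvesFrameSystem.coord {n : ℕ} {K : ℝ → Matrix (Fin n) (Fin n) ℝ} {I : Set ℝ}
    {X : Fin n → ℝ → EuclideanSpace ℝ (Fin n)} (hX : SolvesFrameSystem K I X) (r : Fin n) :
    ∀ i, ∀ t ∈ I, HasDerivWithinAt (fun s => X i s r) (∑ l, K t i l * X l t r) I t :=
  solvesFrameSystem_iff_coord.1 hX r

lemma SolvesFrameSystem.continuousOn {n : ℕ} {K : ℝ → Matrix (Fin n) (Fin n) ℝ} {I : Set ℝ}
    {X : Fin n → ℝ → EuclideanSpace ℝ (Fin n)} (hX : SolvesFrameSystem K I X) (i : Fin n) :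
    ContinuousOn (X i) I :=
  fun t ht => (hX i t ht).continuousWithinAt

/-- A solution of a skew-symmetric system that is orthonormal at one time is always orthonormal:
if `M` is the matrix with rows `X i`, then `Mᵀ M` is constant. -/
lemma SolvesFrameSystem.orthonormal {n : ℕ} {K : ℝ → Matrix (Fin n) (Fin n) ℝ} {I : Set ℝ}
    (hI : I.OrdConnected) (hK : ∀ t ∈ I, ∀ i l, K t i l = -K t l i)
    {X : Fin n → ℝ → EuclideanSpace ℝ (Fin n)} (hX : SolvesFrameSystem K I X) {t₀ : ℝ}
    (ht₀ : t₀ ∈ I) (h₀ : Orthonormal ℝ fun i => X i t₀) {t : ℝ} (ht : t ∈ I) :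
    Orthonormal ℝ fun i => X i t := by
  rw [orthonormal_iff_rowMatrix, mul_eq_one_comm] at h₀ ⊢
  rw [← h₀]
  ext r s
  simpa [Matrix.mul_apply, rowMatrix] using
    sum_mul_eq_of_skew hI hK (hX.coord r) (hX.coord s) ht ht₀

/-- The determinant is continuous on `I` with values in `{1, -1}`. -/
lemma SolvesFrameSystem.det_eq_one {n : ℕ} {K : ℝ → Matrix (Fin n) (Fin n) ℝ} {I : Set ℝ}
    (hI : I.OrdConnected) (hK : ∀ t ∈ I, ∀ i l, K t i l = -K t l i)
    {X : Fin n → ℝ → EuclideanSpace ℝ (Fin n)} (hX : SolvesFrameSystem K I X) {t₀ : ℝ}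
    (ht₀ : t₀ ∈ I) (h₀ : Orthonormal ℝ fun i => X i t₀)
    (h₁ : (rowMatrix fun i => X i t₀).det = 1) {t : ℝ} (ht : t ∈ I) :
    (rowMatrix fun i => X i t).det = 1 := by
  have hc : ContinuousOn (fun t => (rowMatrix fun i => X i t).det) I := by
    simp only [Matrix.det_apply, rowMatrix, Matrix.of_apply]
    refine continuousOn_finsetSum _ fun σ _ => ContinuousOn.const_smul
      (continuousOn_finsetProd _ fun i _ => ?_) _
    exact fun s hs => (hX.coord i (σ i) s hs).continuousWithinAt
  exact hI.isPreconnected.eq_of_sq_eq hc continuousOn_const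
    (fun s hs => by simpa using sq_det_rowMatrix_eq_one (hX.orthonormal hI hK ht₀ h₀ hs))
    (fun _ => one_ne_zero) ht₀ h₁ ht

lemma SolvesFrameSystem.sub {n : ℕ} {K : ℝ → Matrix (Fin n) (Fin n) ℝ} {I : Set ℝ}
    {X Y : Fin n → ℝ → EuclideanSpace ℝ (Fin n)} (hX : SolvesFrameSystem K I X)
    (hY : SolvesFrameSystem K I Y) : SolvesFrameSystem K I (fun i t => X i t - Y i t) := by
  intro i t ht
  simpa only [smul_sub, Finset.sum_sub_distrib] using (hX i t ht).fun_sub (hY i t ht)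

lemma SolvesFrameSystem.map {n : ℕ} {K : ℝ → Matrix (Fin n) (Fin n) ℝ} {I : Set ℝ}
    {X : Fin n → ℝ → EuclideanSpace ℝ (Fin n)} (hX : SolvesFrameSystem K I X)
    (S : EuclideanSpace ℝ (Fin n) →L[ℝ] EuclideanSpace ℝ (Fin n)) :
    SolvesFrameSystem K I (fun i t => S (X i t)) := by
  intro i t ht
  have h := S.hasFDerivAt.comp_hasDerivWithinAt t (hX i t ht)
  simp only [map_sum, map_smul] at h
  exact h

lemma SolvesFrameSystem.unique {n : ℕ} {K : ℝ → Matrix (Fin n) (Fin n) ℝ} {I : Set ℝ}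
    (hI : I.OrdConnected) (hK : ∀ t ∈ I, ∀ i l, K t i l = -K t l i)
    {X Y : Fin n → ℝ → EuclideanSpace ℝ (Fin n)} (hX : SolvesFrameSystem K I X)
    (hY : SolvesFrameSystem K I Y) {t₀ : ℝ} (ht₀ : t₀ ∈ I) (h₀ : ∀ i, X i t₀ = Y i t₀)
    {t : ℝ} (ht : t ∈ I) (i : Fin n) : X i t = Y i t := by
  rw [← sub_eq_zero]
  ext r
  have hD := (hX.sub hY).coord r
  have h := sum_mul_eq_of_skew hI hK hD hD ht ht₀
  simp only [h₀, sub_self, PiLp.zero_apply, mul_zero, Finset.sum_const_zero] at h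
  rw [Finset.sum_eq_zero_iff_of_nonneg fun _ _ => mul_self_nonneg _] at h
  exact mul_self_eq_zero.1 (h i (Finset.mem_univ i))

/-- A skew-symmetric system has a solution with any prescribed value at `t₀`: each coordinate of the
frame solves the same linear equation in `ℝⁿ`. -/
lemma exists_solvesFrameSystem {n : ℕ} {K : ℝ → Matrix (Fin n) (Fin n) ℝ} {I : Set ℝ}
    (hI : I.OrdConnected) (hK : ∀ t ∈ I, ∀ i l, K t i l = -K t l i)
    (hKc : ∀ i l, ContinuousOn (fun t => K t i l) I) {t₀ : ℝ} (ht₀ : t₀ ∈ I)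
    (e : Fin n → EuclideanSpace ℝ (Fin n)) :
    ∃ X : Fin n → ℝ → EuclideanSpace ℝ (Fin n), (∀ i, X i t₀ = e i) ∧ SolvesFrameSystem K I X := by
  have hA : ContinuousOn (fun t => Matrix.toEuclideanCLM (n := Fin n) (𝕜 := ℝ) (K t)) I := by
    rw [continuousOn_clm_apply]
    intro x
    have h : ContinuousOn (fun t => WithLp.toLp 2 fun i => ∑ l, K t i l * x l) I :=
      (PiLp.continuous_toLp 2 _).comp_continuousOn (continuousOn_pi.2 fun i =>
        continuousOn_finsetSum _ fun l _ => (hKc i l).mul continuousOn_const)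
    exact h
  have hskew : ∀ t ∈ I, ∀ x : EuclideanSpace ℝ (Fin n),
      inner ℝ x (Matrix.toEuclideanCLM (𝕜 := ℝ) (K t) x) = 0 := by
    intro t ht x
    have hT : (K t).transpose = -K t := by
      ext i l
      simpa using hK t ht l i
    rw [Matrix.inner_toEuclideanCLM]
    have h : WithLp.ofLp x ⬝ᵥ (K t).mulVec x = -(WithLp.ofLp x ⬝ᵥ (K t).mulVec x) := by
      conv_lhs => rw [Matrix.dotProduct_mulVec, ← Matrix.mulVec_transpose, hT, dotProduct_comm,
        Matrix.neg_mulVec, dotProduct_neg]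
    linarith
  choose x hx0 hx using fun r : Fin n => exists_hasDerivWithinAt_of_skew hI hA hskew ht₀
    (WithLp.toLp 2 fun i => e i r)
  refine ⟨fun i t => WithLp.toLp 2 fun r => x r t i, fun i => ?_, ?_⟩
  · ext r
    simp [hx0]
  · exact solvesFrameSystem_iff_coord.2 fun r i t ht =>
      hasDerivWithinAt_euclidean_iff.1 (hx r t ht) i

/-- Solutions are smooth by bootstrapping: `X` and `K` of class `C^m` make `X' = K X` of class
`C^m`. -/
lemma SolvesFrameSystem.contDiffOn {n : ℕ} {K : ℝ → Matrix (Fin n) (Fin n) ℝ} {I : Set ℝ}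
    (hI : UniqueDiffOn ℝ I) (hKs : ∀ i l, ContDiffOn ℝ ∞ (fun t => K t i l) I)
    {X : Fin n → ℝ → EuclideanSpace ℝ (Fin n)} (hX : SolvesFrameSystem K I X) (i : Fin n) :
    ContDiffOn ℝ ∞ (X i) I := by
  rw [contDiffOn_infty]
  intro m
  induction m generalizing i with
  | zero => exact contDiffOn_zero.2 (hX.continuousOn i)
  | succ m ih =>
    rw [Nat.cast_succ, contDiffOn_succ_iff_derivWithin hI]
    refine ⟨fun t ht => (hX i t ht).differentiableWithinAt, by simp, ?_⟩
    refine ContDiffOn.congr (f := fun t => ∑ l, K t i l • X l t) ?_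
      fun t ht => (hX i t ht).derivWithin (hI t ht)
    exact ContDiffOn.sum fun l _ => ((hKs i l).of_le (by exact_mod_cast le_top)).smul (ih l)

/-! ### The Gram-Schmidt process -/

open InnerProductSpace in
/-- If the vectors `f i`, for `i < m`, have a lower triangular matrix with positive diagonal in the
orthonormal basis `b`, then the Gram-Schmidt process returns positive multiples of the vectors
`b i`. -/
lemma gramSchmidt_eq_smul_of_triangular {F : Type*} [NormedAddCommGroup F] [InnerProductSpace ℝ F]
    {n m : ℕ} (b : OrthonormalBasis (Fin n) ℝ F) {f : ℕ → F}
    (hlow : ∀ i l : Fin n, (i : ℕ) < m → i < l → inner ℝ (f i) (b l) = 0)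
    (hpos : ∀ i : Fin n, (i : ℕ) < m → 0 < inner ℝ (f i) (b i)) (i : Fin n) (hi : (i : ℕ) < m) :
    gramSchmidt ℝ f i = (inner ℝ (f i) (b i) : ℝ) • b i := by
  induction hk : (i : ℕ) using Nat.strong_induction_on generalizing i with
  | _ k ih =>
  subst hk
  refine InnerProductSpace.ext_inner_right_basis b.toBasis fun l => ?_
  rw [OrthonormalBasis.coe_toBasis, inner_smul_left, b.inner_eq_ite]
  rcases lt_or_ge l i with hl | hl
  · rw [if_neg hl.ne', mul_zero]
    have h := gramSchmidt_orthogonal ℝ f (a := (i : ℕ)) (b := (l : ℕ)) (Fin.val_ne_of_ne hl.ne')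
    have hlm : (l : ℕ) < m := lt_trans hl hi
    rw [ih l hl l hlm rfl, inner_smul_right] at h
    exact (mul_eq_zero.1 h).resolve_left (hpos l hlm).ne'
  · have h := congrArg (fun x => (inner ℝ x (b l) : ℝ)) (gramSchmidt_def'' ℝ f (i : ℕ))
    have h0 : ∀ j ∈ Finset.Iio (i : ℕ),
        (inner ℝ (gramSchmidt ℝ f j) (b l) : ℝ) = 0 := by
      intro j hj
      have hji : j < i := Finset.mem_Iio.1 hj
      have hj' : (⟨j, hji.trans i.2⟩ : Fin n) ≠ l := by
        rintro rfl
        exact absurd hl (not_le.2 hji)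
      have := ih j hji ⟨j, hji.trans i.2⟩ (hji.trans hi) rfl
      rw [this, inner_smul_left, b.inner_eq_ite, if_neg hj', mul_zero]
    simp only [inner_add_left, sum_inner, inner_smul_left] at h
    rw [Finset.sum_eq_zero (fun j hj => by rw [h0 j hj, mul_zero]), add_zero] at h
    rw [← h]
    split_ifs with hil
    · subst hil
      simp
    · rw [mul_zero]
      exact hlow i l hi (lt_of_le_of_ne hl hil)

open InnerProductSpace in
lemma gramSchmidtNormed_eq_of_triangular {F : Type*} [NormedAddCommGroup F]
    [InnerProductSpace ℝ F] {n m : ℕ} (b : OrthonormalBasis (Fin n) ℝ F) {f : ℕ → F}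
    (hlow : ∀ i l : Fin n, (i : ℕ) < m → i < l → inner ℝ (f i) (b l) = 0)
    (hpos : ∀ i : Fin n, (i : ℕ) < m → 0 < inner ℝ (f i) (b i)) (i : Fin n) (hi : (i : ℕ) < m) :
    gramSchmidtNormed ℝ f i = b i := by
  have hp := hpos i hi
  rw [gramSchmidtNormed, gramSchmidt_eq_smul_of_triangular b hlow hpos i hi, norm_smul,
    b.norm_eq_one, mul_one, Real.norm_of_nonneg hp.le, smul_smul]
  simp [hp.ne']

open InnerProductSpace in
lemma contDiffOn_gramSchmidt {F : Type*} [NormedAddCommGroup F] [InnerProductSpace ℝ F]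
    {m : WithTop ℕ∞} {I : Set ℝ} {f : ℕ → ℝ → F} (j : ℕ)
    (hf : ∀ i ≤ j, ContDiffOn ℝ m (f i) I)
    (h0 : ∀ i ≤ j, ∀ t ∈ I, gramSchmidt ℝ (fun i => f i t) i ≠ 0) :
    ContDiffOn ℝ m (fun t => gramSchmidt ℝ (fun i => f i t) j) I := by
  induction j using Nat.strong_induction_on with
  | _ j ih =>
  have h : ∀ t, gramSchmidt ℝ (fun i => f i t) j = f j t - ∑ i ∈ Finset.Iio j,
      ((inner ℝ (gramSchmidt ℝ (fun i => f i t) i) (f j t) : ℝ) /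
        ‖gramSchmidt ℝ (fun i => f i t) i‖ ^ 2) • gramSchmidt ℝ (fun i => f i t) i := fun t =>
    eq_sub_of_add_eq (gramSchmidt_def'' ℝ (fun i => f i t) j).symm
  simp only [h]
  refine (hf j le_rfl).sub (ContDiffOn.sum fun i hi => ?_)
  have hij : i < j := Finset.mem_Iio.1 hi
  have hi := ih i hij (fun l hl => hf l (hl.trans hij.le)) fun l hl => h0 l (hl.trans hij.le)
  exact ((hi.inner ℝ (hf j le_rfl)).div (hi.norm_sq ℝ) fun t ht =>
    pow_ne_zero 2 (norm_ne_zero_iff.2 (h0 i hij.le t ht))).smul hi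

open InnerProductSpace in
lemma contDiffOn_gramSchmidtNormed {F : Type*} [NormedAddCommGroup F] [InnerProductSpace ℝ F]
    {m : WithTop ℕ∞} {I : Set ℝ} {f : ℕ → ℝ → F} (j : ℕ)
    (hf : ∀ i ≤ j, ContDiffOn ℝ m (f i) I)
    (h0 : ∀ i ≤ j, ∀ t ∈ I, gramSchmidt ℝ (fun i => f i t) i ≠ 0) :
    ContDiffOn ℝ m (fun t => gramSchmidtNormed ℝ (fun i => f i t) j) I := by
  have h := contDiffOn_gramSchmidt j hf h0
  exact ((h.norm ℝ (h0 j le_rfl)).inv fun t ht => norm_ne_zero_iff.2 (h0 j le_rfl t ht)).smul h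

/-- Vectors with a lower triangular matrix with positive diagonal, with respect to some family `e`,
are linearly independent. -/
lemma linearIndependent_of_triangular {F : Type*} [NormedAddCommGroup F] [InnerProductSpace ℝ F]
    {m : ℕ} {e f : Fin m → F} (hlow : ∀ i l, i < l → inner ℝ (f i) (e l) = 0)
    (hpos : ∀ i, 0 < inner ℝ (f i) (e i)) : LinearIndependent ℝ f := by
  rw [Fintype.linearIndependent_iff]
  intro c hc
  let M : Matrix (Fin m) (Fin m) ℝ := Matrix.of fun i l => inner ℝ (f i) (e l)
  have hM : M.det ≠ 0 := by
    rw [Matrix.det_of_isLowerTriangular M fun i l h => hlow i l h]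
    exact Finset.prod_ne_zero_iff.2 fun i _ => (hpos i).ne'
  have h0 : Matrix.vecMul c M = 0 := by
    ext l
    have h := congrArg (fun x => (inner ℝ x (e l) : ℝ)) hc
    simpa [sum_inner, inner_smul_left, Matrix.vecMul, dotProduct, M] using h
  exact congrFun (Matrix.eq_zero_of_vecMul_eq_zero hM h0)

/-! ### The cross product and positively oriented frames -/

/-- The defining property of the cross product: its inner product with `x` is
`det (w 1, …, w (n-1), x)`. -/
lemma inner_cross {n : ℕ} (hn : 0 < n) (w : ℕ → EuclideanSpace ℝ (Fin n))
    (x : EuclideanSpace ℝ (Fin n)) :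
    inner ℝ (cross w) x = (Matrix.of fun r c : Fin n =>
      if (c : ℕ) + 1 = n then x r else w ((c : ℕ) + 1) r).det := by
  let z : Fin n := ⟨n - 1, by omega⟩
  have hz : ∀ c : Fin n, (c : ℕ) + 1 = n ↔ c = z := fun c => by
    rw [Fin.ext_iff]
    change _ ↔ (c : ℕ) = n - 1
    omega
  let A : Matrix (Fin n) (Fin n) ℝ := Matrix.of fun r c => w ((c : ℕ) + 1) r
  -- both sides are evaluated through the last row of the adjugate of `A`
  have hA : ∀ v : Fin n → ℝ, (Matrix.of fun r c : Fin n =>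
      if (c : ℕ) + 1 = n then v r else w ((c : ℕ) + 1) r).det = (A.adjugate.mulVec v) z := by
    intro v
    rw [← Matrix.cramer_eq_adjugate_mulVec, Matrix.cramer_apply]
    congr 1
    ext r c
    simp [Matrix.updateCol_apply, hz, A]
  have hc : ∀ i, cross w i = A.adjugate z i := by
    intro i
    have h := hA (Pi.single i 1)
    rw [Matrix.mulVec_single_one] at h
    simpa [cross, Pi.single_apply] using h
  rw [hA, PiLp.inner_apply]
  simp [hc, Matrix.mulVec, dotProduct, mul_comm]

/-- The cross product of all but the last vector of a positively oriented orthonormal basis is the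
last vector. -/
lemma cross_eq_of_orthonormal {n : ℕ} {e : Fin n → EuclideanSpace ℝ (Fin n)}
    (he : Orthonormal ℝ e) (hdet : (rowMatrix e).det = 1) {w : ℕ → EuclideanSpace ℝ (Fin n)}
    (hw : ∀ i : Fin n, (i : ℕ) + 1 < n → w ((i : ℕ) + 1) = e i) (z : Fin n)
    (hz : (z : ℕ) + 1 = n) : cross w = e z := by
  refine InnerProductSpace.ext_inner_right_basis (orthonormalBasisOf he).toBasis fun l => ?_
  rw [OrthonormalBasis.coe_toBasis, orthonormalBasisOf_apply, inner_cross (by omega),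
    orthonormal_iff_ite.1 he]
  split_ifs with hl
  · subst hl
    rw [← hdet, ← Matrix.det_transpose (rowMatrix e)]
    congr 1
    ext r c
    simp only [Matrix.of_apply, Matrix.transpose_apply, rowMatrix]
    split_ifs with hc
    · rw [show c = z from Fin.ext (by omega)]
    · rw [hw c (by omega)]
  · have hl' : (l : ℕ) + 1 < n := by
      have : (l : ℕ) ≠ z := fun h => hl (Fin.ext h).symm
      omega
    refine Matrix.det_zero_of_column_eq (Ne.symm hl) fun r => ?_
    simp [hl'.ne, hz, hw l hl']

/-- An orthonormal family of `n - 1` vectors of `ℝⁿ` extends to a positively oriented orthonormal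
basis. -/
lemma exists_orthonormal_det_eq_one {n : ℕ} {w : ℕ → EuclideanSpace ℝ (Fin n)} (z : Fin n)
    (hz : (z : ℕ) + 1 = n)
    (hw : Orthonormal ℝ fun i : {i : Fin n | (i : ℕ) + 1 < n} => w ((i : ℕ) + 1)) :
    ∃ e : Fin n → EuclideanSpace ℝ (Fin n), Orthonormal ℝ e ∧ (rowMatrix e).det = 1 ∧
      ∀ i : Fin n, (i : ℕ) + 1 < n → w ((i : ℕ) + 1) = e i := by
  obtain ⟨b, hb⟩ := Orthonormal.exists_orthonormalBasis_extension_of_card_eq (𝕜 := ℝ)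
    (E := EuclideanSpace ℝ (Fin n)) (ι := Fin n) (by simp)
    (v := fun i : Fin n => w ((i : ℕ) + 1)) (s := {i : Fin n | (i : ℕ) + 1 < n}) hw
  have hs := sq_det_rowMatrix_eq_one b.orthonormal
  set s := (rowMatrix b).det with hsdef
  -- the last vector is multiplied by the sign of the determinant
  let c : Fin n → ℝ := fun i => if (i : ℕ) + 1 < n then 1 else s
  have hc : ∀ i, c i * c i = 1 := fun i => by
    by_cases h : (i : ℕ) + 1 < n
    · simp [c, h]
    · simpa [c, h, sq] using hs
  refine ⟨fun i => c i • b i, ?_, ?_, fun i hi => ?_⟩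
  · rw [orthonormal_iff_ite]
    intro i j
    rw [inner_smul_left, inner_smul_right, b.inner_eq_ite]
    split_ifs with h
    · subst h
      simpa using hc i
    · simp
  · have hM : rowMatrix (fun i => c i • b i) = Matrix.diagonal c * rowMatrix b := by
      ext i r
      simp [rowMatrix, Matrix.diagonal_mul]
    have hprod : ∏ i, c i = c z := Finset.prod_eq_single z (fun i _ hi => by
      have : (i : ℕ) ≠ z := fun h => hi (Fin.ext h)
      exact if_pos (by omega)) (by simp)
    rw [hM, Matrix.det_mul, Matrix.det_diagonal, hprod, ← hsdef]
    simpa [c, hz, sq] using hs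
  · have h := hb i hi
    simp [c, hi, h]

/-- Appending the cross product to `n - 1` orthonormal vectors gives a positively oriented
orthonormal basis, namely the one of `exists_orthonormal_det_eq_one`. -/
lemma orthonormal_and_det_eq_one_of_cross {n : ℕ} {w : ℕ → EuclideanSpace ℝ (Fin n)} (hn : 0 < n)
    (hw : Orthonormal ℝ fun i : {i : Fin n | (i : ℕ) + 1 < n} => w ((i : ℕ) + 1))
    {e : Fin n → EuclideanSpace ℝ (Fin n)}
    (he : ∀ i : Fin n, e i = if (i : ℕ) + 1 = n then cross w else w ((i : ℕ) + 1)) :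
    Orthonormal ℝ e ∧ (rowMatrix e).det = 1 := by
  have hz : ((⟨n - 1, by omega⟩ : Fin n) : ℕ) + 1 = n := Nat.sub_add_cancel hn
  obtain ⟨e', h1, h2, h3⟩ := exists_orthonormal_det_eq_one _ hz hw
  have hee : e = e' := by
    funext i
    rw [he]
    split_ifs with h
    · exact cross_eq_of_orthonormal h1 h2 h3 i h
    · exact h3 i (by omega)
  rw [hee]
  exact ⟨h1, h2⟩

lemma contDiffOn_cross {n : ℕ} {m : WithTop ℕ∞} {I : Set ℝ}
    {w : ℕ → ℝ → EuclideanSpace ℝ (Fin n)}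
    (hw : ∀ i, 1 ≤ i → i < n → ContDiffOn ℝ m (w i) I) :
    ContDiffOn ℝ m (fun t => cross fun i => w i t) I := by
  rw [contDiffOn_euclidean]
  intro i
  simp only [cross, Matrix.det_apply, Matrix.of_apply]
  refine ContDiffOn.sum fun σ _ => ContDiffOn.const_smul _ (contDiffOn_prod fun c _ => ?_)
  split_ifs
  · exact contDiffOn_const
  · exact contDiffOn_const
  · exact contDiffOn_euclidean.1 (hw _ (by omega) (by omega)) _

/-! ### The Frenet frame of a regular curve -/

lemma hasDerivWithinAt_iteratedDerivWithin {F : Type*} [NormedAddCommGroup F] [NormedSpace ℝ F]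
    {I : Set ℝ} (hI : UniqueDiffOn ℝ I) {f : ℝ → F} (hf : ContDiffOn ℝ ∞ f I) (m : ℕ)
    {t : ℝ} (ht : t ∈ I) :
    HasDerivWithinAt (iteratedDerivWithin m f I) (iteratedDerivWithin (m + 1) f I t) I t := by
  rw [iteratedDerivWithin_succ]
  exact (hf.differentiableOn_iteratedDerivWithin (by exact_mod_cast WithTop.coe_lt_top m) hI
    t ht).hasDerivWithinAt

lemma contDiffOn_iteratedDerivWithin {F : Type*} [NormedAddCommGroup F] [NormedSpace ℝ F]
    {I : Set ℝ} (hI : UniqueDiffOn ℝ I) {f : ℝ → F} (hf : ContDiffOn ℝ ∞ f I) (m : ℕ) :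
    ContDiffOn ℝ ∞ (iteratedDerivWithin m f I) I := by
  induction m with
  | zero => rwa [iteratedDerivWithin_zero]
  | succ m ih =>
    exact (ih.derivWithin hI le_rfl).congr fun t _ => by rw [iteratedDerivWithin_succ]

/-- If `⟪x, y⟫` is constant on `I`, then `⟪x', y⟫ = -⟪x, y'⟫`. -/
lemma inner_deriv_eq_neg {F : Type*} [NormedAddCommGroup F] [InnerProductSpace ℝ F]
    {I : Set ℝ} (hI : UniqueDiffOn ℝ I) {x y : ℝ → F} {x' y' : F} {c t : ℝ} (ht : t ∈ I)
    (hx : HasDerivWithinAt x x' I t) (hy : HasDerivWithinAt y y' I t)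
    (h : ∀ s ∈ I, inner ℝ (x s) (y s) = c) : (inner ℝ x' (y t) : ℝ) = -inner ℝ (x t) y' := by
  have h1 : HasDerivWithinAt (fun s => (inner ℝ (x s) (y s) : ℝ)) 0 I t :=
    (hasDerivWithinAt_const t I c).congr h (h t ht)
  have h2 := (hI t ht).eq_deriv _ (hx.inner ℝ hy) h1
  linarith

lemma gramSchmidt_iteratedDerivWithin_ne_zero {n m : ℕ} {I : Set ℝ}
    {f : ℝ → EuclideanSpace ℝ (Fin n)} (hf : IsRegularCurve m I f) {i : ℕ} (hi : i < m)
    {t : ℝ} (ht : t ∈ I) :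
    InnerProductSpace.gramSchmidt ℝ (fun j : ℕ => iteratedDerivWithin (j + 1) f I t) i ≠ 0 := by
  refine InnerProductSpace.gramSchmidt_ne_zero_coe i ?_
  exact (hf.2 t ht).comp (fun j : Set.Iic i => (⟨j, lt_of_le_of_lt j.2 hi⟩ : Fin m))
    fun a b h => Subtype.ext (congrArg Fin.val h)

lemma frenetFrame_eq_gramSchmidtFrame {n : ℕ} {I : Set ℝ} {f : ℝ → EuclideanSpace ℝ (Fin n)}
    {i : ℕ} (hi : i + 1 < n) (t : ℝ) :
    frenetFrame I f (i + 1) t = InnerProductSpace.gramSchmidtNormed ℝ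
      (fun j : ℕ => iteratedDerivWithin (j + 1) f I t) i := by
  rw [frenetFrame, if_neg hi.ne]
  rfl

lemma orthonormal_frenetFrame {n : ℕ} (hn : 0 < n) {I : Set ℝ}
    {f : ℝ → EuclideanSpace ℝ (Fin n)} (hf : IsRegularCurve (n - 1) I f) {t : ℝ} (ht : t ∈ I) :
    Orthonormal ℝ (fun i : Fin n => frenetFrame I f ((i : ℕ) + 1) t) ∧
      (rowMatrix fun i : Fin n => frenetFrame I f ((i : ℕ) + 1) t).det = 1 := by
  refine orthonormal_and_det_eq_one_of_cross hn (w := fun i => gramSchmidtFrame I f i t) ?_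
    fun i => rfl
  have hne : ∀ i : Fin n, (i : ℕ) + 1 < n → InnerProductSpace.gramSchmidtNormed ℝ
      (fun j : ℕ => iteratedDerivWithin (j + 1) f I t) i ≠ 0 := fun i hi => by
    have h := gramSchmidt_iteratedDerivWithin_ne_zero hf (i := i) (by omega) ht
    exact smul_ne_zero (inv_ne_zero (by simpa using h)) h
  exact (InnerProductSpace.gramSchmidtNormed_orthonormal' (𝕜 := ℝ)
    (fun j : ℕ => iteratedDerivWithin (j + 1) f I t)).comp
    (fun i : {i : Fin n | (i : ℕ) + 1 < n} => ⟨((i : Fin n) : ℕ), hne i i.2⟩)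
    fun a b h => Subtype.ext (Fin.ext (congrArg Subtype.val h))

lemma contDiffOn_frenetFrame {n : ℕ} {I : Set ℝ} (hI : UniqueDiffOn ℝ I)
    {f : ℝ → EuclideanSpace ℝ (Fin n)} (hf : IsRegularCurve (n - 1) I f) (i : Fin n) :
    ContDiffOn ℝ ∞ (frenetFrame I f ((i : ℕ) + 1)) I := by
  have h : ∀ j, 1 ≤ j → j < n → ContDiffOn ℝ ∞ (gramSchmidtFrame I f j) I := fun j hj hjn =>
    contDiffOn_gramSchmidtNormed (j - 1)
      (fun l _ => contDiffOn_iteratedDerivWithin hI hf.1 (l + 1))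
      fun l hl t ht => gramSchmidt_iteratedDerivWithin_ne_zero hf (by omega) ht
  by_cases hi : (i : ℕ) + 1 = n
  · exact (contDiffOn_cross h).congr fun t _ => if_pos hi
  · exact (h _ (by omega) (by omega)).congr fun t _ => if_neg hi

lemma frenetFrame_mem_span {n : ℕ} {I : Set ℝ} {f : ℝ → EuclideanSpace ℝ (Fin n)} {i : ℕ}
    (hi : i + 1 < n) (t : ℝ) : frenetFrame I f (i + 1) t ∈ Submodule.span ℝ
      ((fun j : ℕ => iteratedDerivWithin (j + 1) f I t) '' Iic i) := by
  rw [frenetFrame_eq_gramSchmidtFrame hi]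
  exact Submodule.smul_mem _ _ (InnerProductSpace.gramSchmidt_mem_span ℝ _ le_rfl)

/-- The vector `V_j` of the Frenet frame is orthogonal to the derivatives of order less than `j`;
here `j = l + 1`. -/
lemma inner_frenetFrame_iteratedDerivWithin {n : ℕ} {I : Set ℝ}
    {f : ℝ → EuclideanSpace ℝ (Fin n)} (hf : IsRegularCurve (n - 1) I f) {t : ℝ} (ht : t ∈ I)
    (l : Fin n) {m : ℕ} (hm : m < l) :
    inner ℝ (frenetFrame I f ((l : ℕ) + 1) t) (iteratedDerivWithin (m + 1) f I t) = 0 := by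
  set D : ℕ → EuclideanSpace ℝ (Fin n) := fun j => iteratedDerivWithin (j + 1) f I t with hD
  have hmem : D m ∈ Submodule.span ℝ (InnerProductSpace.gramSchmidtNormed ℝ D '' Iic m) := by
    rw [InnerProductSpace.span_gramSchmidtNormed, InnerProductSpace.span_gramSchmidt_Iic]
    exact Submodule.subset_span ⟨m, self_mem_Iic, rfl⟩
  have hle : Submodule.span ℝ (InnerProductSpace.gramSchmidtNormed ℝ D '' Iic m) ≤
      (ℝ ∙ frenetFrame I f ((l : ℕ) + 1) t)ᗮ := by
    rw [Submodule.span_le]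
    rintro _ ⟨j, hj, rfl⟩
    have hjl : j < l := lt_of_le_of_lt hj hm
    have hjn : j + 1 < n := by omega
    rw [SetLike.mem_coe, Submodule.mem_orthogonal_singleton_iff_inner_right,
      ← frenetFrame_eq_gramSchmidtFrame hjn]
    exact (orthonormal_frenetFrame (by omega) hf ht).1.2 (i := l) (j := ⟨j, by omega⟩)
      fun h => hjl.ne' (congrArg Fin.val h)
  exact Submodule.mem_orthogonal_singleton_iff_inner_right.1 (hle hmem)

lemma derivWithin_eq_speed_smul {n : ℕ} (hn : 2 ≤ n) {I : Set ℝ}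
    {f : ℝ → EuclideanSpace ℝ (Fin n)} {t : ℝ} (hs : speed I f t ≠ 0) :
    derivWithin f I t = speed I f t • frenetFrame I f 1 t := by
  rw [frenetFrame_eq_gramSchmidtFrame (i := 0) (by omega), InnerProductSpace.gramSchmidtNormed,
    show (0 : ℕ) = ⊥ from rfl, InnerProductSpace.gramSchmidt_bot]
  simp only [Nat.bot_eq_zero, zero_add, iteratedDerivWithin_one, smul_smul]
  rw [speed] at hs ⊢
  simp [hs]

/-! ### The Frenet equations -/

/-- The coefficient matrix of the Frenet equations with speed `ν` and curvatures `k`. The rows and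
columns are numbered from `0`, the curvatures from `1`: the entry in row `i` and column `i + 1` is
`ν k_{i+1}`. -/
noncomputable def frenetMatrix {n : ℕ} (ν : ℝ → ℝ) (k : ℕ → ℝ → ℝ) (t : ℝ) :
    Matrix (Fin n) (Fin n) ℝ :=
  Matrix.of fun i l => if (i : ℕ) + 1 = l then ν t * k l t
    else if (l : ℕ) + 1 = i then -(ν t * k i t) else 0

lemma frenetMatrix_skew {n : ℕ} (ν : ℝ → ℝ) (k : ℕ → ℝ → ℝ) (t : ℝ) (i l : Fin n) :
    frenetMatrix ν k t i l = -frenetMatrix ν k t l i := by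
  simp only [frenetMatrix, Matrix.of_apply]
  split_ifs <;> first | omega | simp

lemma frenetMatrix_of_succ {n : ℕ} (ν : ℝ → ℝ) (k : ℕ → ℝ → ℝ) (t : ℝ) {i l : Fin n}
    (h : (i : ℕ) + 1 = l) : frenetMatrix ν k t i l = ν t * k l t := by
  simp [frenetMatrix, h]

lemma frenetMatrix_of_ne {n : ℕ} (ν : ℝ → ℝ) (k : ℕ → ℝ → ℝ) (t : ℝ) {i l : Fin n}
    (h : (i : ℕ) + 1 ≠ l) (h' : (l : ℕ) + 1 ≠ i) : frenetMatrix ν k t i l = 0 := by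
  simp [frenetMatrix, h, h']

/-- The Frenet equations. The coefficient `⟪V_i', V_l⟫` vanishes for `l > i + 1`: it equals
`-⟪V_i, V_l'⟫`, where `V_i` is a combination of `f', …, f^{(i)}`, and
`⟪V_l', f^{(m)}⟫ = -⟪V_l, f^{(m+1)}⟫ = 0` for `m ≤ i`. -/
lemma HasSpeedAndCurvatures.solvesFrameSystem {n : ℕ} {I : Set ℝ} (hI : UniqueDiffOn ℝ I)
    {f : ℝ → EuclideanSpace ℝ (Fin n)} {ν : ℝ → ℝ} {k : ℕ → ℝ → ℝ}
    (hf : HasSpeedAndCurvatures I f ν k) (hν : ∀ t ∈ I, ν t ≠ 0) :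
    SolvesFrameSystem (frenetMatrix ν k) I fun i t => frenetFrame I f ((i : ℕ) + 1) t := by
  obtain ⟨hreg, hspeed, hcurv⟩ := hf
  intro i t ht
  have hn : 0 < n := i.pos
  set V : Fin n → ℝ → EuclideanSpace ℝ (Fin n) := fun i t => frenetFrame I f ((i : ℕ) + 1) t
    with hV
  have hon : ∀ s ∈ I, Orthonormal ℝ fun i => V i s := fun s hs =>
    (orthonormal_frenetFrame hn hreg hs).1
  have hd : ∀ i, HasDerivWithinAt (V i) (derivWithin (V i) I t) I t := fun i =>
    ((contDiffOn_frenetFrame hI hreg i).differentiableOn (by simp) t ht).hasDerivWithinAt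
  have hskew : ∀ i l, (inner ℝ (derivWithin (V i) I t) (V l t) : ℝ) =
      -inner ℝ (derivWithin (V l) I t) (V i t) := fun i l => by
    rw [real_inner_comm (V i t)]
    exact inner_deriv_eq_neg hI ht (hd i) (hd l) fun s hs => orthonormal_iff_ite.1 (hon s hs) i l
  have hfar : ∀ i l : Fin n, (i : ℕ) + 1 < l →
      (inner ℝ (derivWithin (V l) I t) (V i t) : ℝ) = 0 := by
    intro i l hil
    have hle : Submodule.span ℝ ((fun j : ℕ => iteratedDerivWithin (j + 1) f I t) '' Iic (i : ℕ))
        ≤ (ℝ ∙ derivWithin (V l) I t)ᗮ := by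
      rw [Submodule.span_le]
      rintro _ ⟨m, hm, rfl⟩
      have hm' : m ≤ i := hm
      rw [SetLike.mem_coe, Submodule.mem_orthogonal_singleton_iff_inner_right]
      rw [inner_deriv_eq_neg hI ht (hd l)
        (hasDerivWithinAt_iteratedDerivWithin hI hreg.1 (m + 1) ht)
        fun s hs => inner_frenetFrame_iteratedDerivWithin hreg hs l (by omega),
        inner_frenetFrame_iteratedDerivWithin hreg ht l (by omega), neg_zero]
    exact Submodule.mem_orthogonal_singleton_iff_inner_right.1
      (hle (frenetFrame_mem_span (by omega) t))
  have hnext : ∀ i l : Fin n, (i : ℕ) + 1 = l →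
      (inner ℝ (derivWithin (V i) I t) (V l t) : ℝ) = ν t * k l t := by
    intro i l hil
    have h := hcurv ((i : ℕ) + 1) (by omega) (by omega) t ht
    rw [curvature, hspeed t ht, div_eq_iff (hν t ht)] at h
    rw [← hil, mul_comm, ← h]
    simp only [hV, hil]
  have hcoef : ∀ l, (inner ℝ (V l t) (derivWithin (V i) I t) : ℝ) = frenetMatrix ν k t i l := by
    intro l
    rw [real_inner_comm]
    rcases lt_trichotomy i l with h | h | h
    · by_cases h' : (i : ℕ) + 1 = l
      · rw [hnext i l h', frenetMatrix_of_succ ν k t h']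
      · have : (i : ℕ) < l := h
        rw [hskew, hfar i l (by omega), frenetMatrix_of_ne ν k t h' (by omega), neg_zero]
    · subst h
      rw [frenetMatrix_of_ne ν k t (by omega) (by omega)]
      have := hskew i i
      linarith
    · have hlt : (l : ℕ) < i := h
      by_cases h' : (l : ℕ) + 1 = i
      · rw [hskew, hnext l i h', frenetMatrix_skew, frenetMatrix_of_succ ν k t h']
      · rw [hfar l i (by omega), frenetMatrix_of_ne ν k t (by omega) h']
  have hsum := (orthonormalBasisOf (hon t ht)).sum_repr' (derivWithin (V i) I t)
  simp only [orthonormalBasisOf_apply, hcoef] at hsum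
  exact hsum ▸ hd i

/-! ### Rigidity -/

lemma det_linearMap_eq_one {n : ℕ}
    (S : EuclideanSpace ℝ (Fin n) →ₗ[ℝ] EuclideanSpace ℝ (Fin n))
    {e e' : Fin n → EuclideanSpace ℝ (Fin n)} (he : (rowMatrix e).det = 1)
    (he' : (rowMatrix e').det = 1) (h : ∀ i, S (e i) = e' i) : LinearMap.det S = 1 := by
  have hb : ∀ v : Fin n → EuclideanSpace ℝ (Fin n),
      (EuclideanSpace.basisFun (Fin n) ℝ).toBasis.det v = (rowMatrix v).det := fun v => by
    rw [Module.Basis.det_apply, ← Matrix.det_transpose]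
    rfl
  have hcomp := (EuclideanSpace.basisFun (Fin n) ℝ).toBasis.det_comp S e
  rw [hb, hb, he, mul_one, show S ∘ e = e' from funext h, he'] at hcomp
  exact hcomp.symm

/-- Two curves with the same speed and curvatures differ by an orientation preserving isometry: its
linear part carries one Frenet frame to the other at one time, hence at all times. -/
lemma exists_isometry_of_hasSpeedAndCurvatures {n : ℕ} (hn : 2 ≤ n) {I : Set ℝ}
    (hI : I.OrdConnected) (hI' : UniqueDiffOn ℝ I) (hne : I.Nonempty)
    {f g : ℝ → EuclideanSpace ℝ (Fin n)} {ν : ℝ → ℝ} {k : ℕ → ℝ → ℝ} (hν : ∀ t ∈ I, ν t ≠ 0)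
    (hf : HasSpeedAndCurvatures I f ν k) (hg : HasSpeedAndCurvatures I g ν k) :
    ∃ F : EuclideanSpace ℝ (Fin n) ≃ᵃⁱ[ℝ] EuclideanSpace ℝ (Fin n),
      OrientationPreserving F ∧ ∀ t ∈ I, g t = F (f t) := by
  obtain ⟨t₀, ht₀⟩ := hne
  obtain ⟨hof, hdf⟩ := orthonormal_frenetFrame (by omega) hf.1 ht₀
  obtain ⟨hog, hdg⟩ := orthonormal_frenetFrame (by omega) hg.1 ht₀
  let S := (orthonormalBasisOf hof).equiv (orthonormalBasisOf hog) (Equiv.refl _)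
  have hS : ∀ i : Fin n, S (frenetFrame I f ((i : ℕ) + 1) t₀) =
      frenetFrame I g ((i : ℕ) + 1) t₀ := fun i => by
    have h := (orthonormalBasisOf hof).equiv_apply_basis (orthonormalBasisOf hog) (Equiv.refl _) i
    simpa using h
  have hframe : ∀ t ∈ I, S (frenetFrame I f 1 t) = frenetFrame I g 1 t := fun t ht =>
    ((hf.solvesFrameSystem hI' hν).map
      (S.toContinuousLinearEquiv : EuclideanSpace ℝ (Fin n) →L[ℝ] _)).unique hI
      (fun t _ => frenetMatrix_skew ν k t) (hg.solvesFrameSystem hI' hν) ht₀ hS ht ⟨0, by omega⟩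
  have hderiv : ∀ {h : ℝ → EuclideanSpace ℝ (Fin n)}, HasSpeedAndCurvatures I h ν k → ∀ t ∈ I,
      HasDerivWithinAt h (ν t • frenetFrame I h 1 t) I t := fun {h} hh t ht => by
    rw [← hh.2.1 t ht, ← derivWithin_eq_speed_smul hn (by rw [hh.2.1 t ht]; exact hν t ht)]
    exact (hh.1.1.differentiableOn (by simp) t ht).hasDerivWithinAt
  have hconst : ∀ t ∈ I, g t - S (f t) = g t₀ - S (f t₀) := fun t ht =>
    eq_of_hasDerivWithinAt_zero hI (f := fun t => g t - S (f t)) (fun s hs => by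
      have h := (hderiv hg s hs).fun_sub
        ((S.toContinuousLinearEquiv : EuclideanSpace ℝ (Fin n) →L[ℝ]
          EuclideanSpace ℝ (Fin n)).hasFDerivAt.comp_hasDerivWithinAt s (hderiv hf s hs))
      have h0 : ν s • frenetFrame I g 1 s - S (ν s • frenetFrame I f 1 s) = 0 := by
        rw [map_smul, hframe s hs, sub_self]
      exact h0 ▸ h) ht ht₀
  refine ⟨S.toAffineIsometryEquiv.trans
    (AffineIsometryEquiv.constVAdd ℝ (EuclideanSpace ℝ (Fin n)) (g t₀ - S (f t₀))), ?_,
    fun t ht => ?_⟩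
  · exact det_linearMap_eq_one _ hdf hdg hS
  · change g t = (g t₀ - S (f t₀)) + S (f t)
    rw [← hconst t ht, sub_add_cancel]

/-! ### Existence -/

/-- The derivatives of a curve `f` with `f' = ν X_0`, where the frame `X` solves the Frenet
equations, have a lower triangular matrix with positive diagonal in this frame. This is an induction
on the order `m`, by differentiation of `⟪f^{(m)}, X_l⟫ = 0` for `l ≥ m`. -/
lemma inner_iteratedDerivWithin_frame {n : ℕ} {I : Set ℝ} (hI : UniqueDiffOn ℝ I)
    {ν : ℝ → ℝ} {k : ℕ → ℝ → ℝ} (hν_pos : ∀ t ∈ I, 0 < ν t)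
    (hk_pos : ∀ j : ℕ, 1 ≤ j → j ≤ n - 2 → ∀ t ∈ I, 0 < k j t)
    {X : Fin n → ℝ → EuclideanSpace ℝ (Fin n)} (hX : SolvesFrameSystem (frenetMatrix ν k) I X)
    (hon : ∀ t ∈ I, Orthonormal ℝ fun i => X i t)
    {f : ℝ → EuclideanSpace ℝ (Fin n)} (hf : ContDiffOn ℝ ∞ f I) (z : Fin n) (hz : (z : ℕ) = 0)
    (hf' : ∀ t ∈ I, derivWithin f I t = ν t • X z t) (m : ℕ) (hm : m < n - 1) :
    ∀ t ∈ I, ∀ l : Fin n,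
      (m < l → inner ℝ (iteratedDerivWithin (m + 1) f I t) (X l t) = 0) ∧
      (m = l → 0 < inner ℝ (iteratedDerivWithin (m + 1) f I t) (X l t)) := by
  induction m with
  | zero =>
    intro t ht l
    rw [zero_add, iteratedDerivWithin_one, hf' t ht, inner_smul_left,
      orthonormal_iff_ite.1 (hon t ht)]
    refine ⟨fun h => ?_, fun h => ?_⟩
    · rw [if_neg (by rintro rfl; omega), mul_zero]
    · rw [if_pos (Fin.ext (by omega)), mul_one]
      exact hν_pos t ht
  | succ m ih =>
    have ih := ih (by omega)
    intro t ht l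
    have key : m + 1 ≤ l → (inner ℝ (iteratedDerivWithin (m + 1 + 1) f I t) (X l t) : ℝ) =
        -∑ p, frenetMatrix ν k t l p * inner ℝ (iteratedDerivWithin (m + 1) f I t) (X p t) := by
      intro h
      rw [inner_deriv_eq_neg hI ht (hasDerivWithinAt_iteratedDerivWithin hI hf (m + 1) ht)
        (hX l t ht) fun s hs => (ih s hs l).1 h]
      simp [inner_sum, inner_smul_right]
    refine ⟨fun h => ?_, fun h => ?_⟩
    · rw [key h.le, Finset.sum_eq_zero, neg_zero]
      intro p _
      by_cases hp : m < p
      · rw [(ih t ht p).1 hp, mul_zero]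
      · rw [frenetMatrix_of_ne ν k t (by omega) (by omega), zero_mul]
    · have hmn : m < n := by omega
      rw [key h.le, Finset.sum_eq_single ⟨m, hmn⟩, frenetMatrix_skew,
        frenetMatrix_of_succ ν k t (i := ⟨m, hmn⟩) h, neg_mul, neg_neg]
      · exact mul_pos (mul_pos (hν_pos t ht) (hk_pos l (by omega) (by omega) t ht))
          ((ih t ht ⟨m, hmn⟩).2 rfl)
      · intro p _ hp
        have hpm : (p : ℕ) ≠ m := fun h => hp (Fin.ext h)
        by_cases hp' : m < p
        · rw [(ih t ht p).1 hp', mul_zero]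
        · rw [frenetMatrix_of_ne ν k t (by omega) (by omega), zero_mul]
      · simp

/-- A curve with `f' = ν X_0`, where `X` is a positively oriented orthonormal frame that solves the
Frenet equations, has speed `ν`, Frenet frame `X` and curvatures `k`. -/
lemma hasSpeedAndCurvatures_of_frame {n : ℕ} {I : Set ℝ} (hI : UniqueDiffOn ℝ I)
    {ν : ℝ → ℝ} {k : ℕ → ℝ → ℝ} (hν_pos : ∀ t ∈ I, 0 < ν t)
    (hk_pos : ∀ j : ℕ, 1 ≤ j → j ≤ n - 2 → ∀ t ∈ I, 0 < k j t)
    {X : Fin n → ℝ → EuclideanSpace ℝ (Fin n)} (hX : SolvesFrameSystem (frenetMatrix ν k) I X)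
    (hon : ∀ t ∈ I, Orthonormal ℝ fun i => X i t)
    (hdet : ∀ t ∈ I, (rowMatrix fun i => X i t).det = 1)
    {f : ℝ → EuclideanSpace ℝ (Fin n)} (hf : ContDiffOn ℝ ∞ f I) (z : Fin n) (hz : (z : ℕ) = 0)
    (hf' : ∀ t ∈ I, derivWithin f I t = ν t • X z t) : HasSpeedAndCurvatures I f ν k := by
  have htri := inner_iteratedDerivWithin_frame hI hν_pos hk_pos hX hon hf z hz hf'
  have hgs : ∀ t ∈ I, ∀ i : Fin n, (i : ℕ) + 1 < n →
      gramSchmidtFrame I f ((i : ℕ) + 1) t = X i t := by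
    intro t ht i hi
    have h := gramSchmidtNormed_eq_of_triangular (m := n - 1) (orthonormalBasisOf (hon t ht))
      (f := fun j : ℕ => iteratedDerivWithin (j + 1) f I t)
      (fun i l hi hil => by simpa using (htri i hi t ht l).1 hil)
      (fun i hi => by simpa using (htri i hi t ht i).2 rfl) i (by omega)
    rw [orthonormalBasisOf_apply] at h
    exact h
  have hframe : ∀ t ∈ I, ∀ i : Fin n, frenetFrame I f ((i : ℕ) + 1) t = X i t := by
    intro t ht i
    rw [frenetFrame]
    split_ifs with h
    · exact cross_eq_of_orthonormal (hon t ht) (hdet t ht) (hgs t ht) i h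
    · exact hgs t ht i (by omega)
  have hspeed : ∀ t ∈ I, speed I f t = ν t := fun t ht => by
    rw [speed, hf' t ht, norm_smul, (hon t ht).1, mul_one, Real.norm_of_nonneg (hν_pos t ht).le]
  refine ⟨⟨hf, fun t ht => ?_⟩, hspeed, fun j hj1 hjn t ht => ?_⟩
  · exact linearIndependent_of_triangular (e := fun i : Fin (n - 1) => X ⟨i, by omega⟩ t)
      (fun i l hil => (htri i i.2 t ht ⟨l, by omega⟩).1 hil)
      fun i => (htri i i.2 t ht ⟨i, by omega⟩).2 rfl
  · let i : Fin n := ⟨j - 1, by omega⟩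
    let l : Fin n := ⟨j, by omega⟩
    have hij : (i : ℕ) + 1 = j := Nat.sub_add_cancel hj1
    have h1 : ∀ s ∈ I, frenetFrame I f j s = X i s := fun s hs => by
      rw [← hframe s hs i, hij]
    have h2 : derivWithin (fun s => frenetFrame I f j s) I t =
        ∑ p, frenetMatrix ν k t i p • X p t :=
      ((hX i t ht).congr h1 (h1 t ht)).derivWithin (hI t ht)
    rw [curvature, h2, hspeed t ht, hframe t ht l, div_eq_iff (hν_pos t ht).ne', sum_inner,
      Finset.sum_eq_single l]
    · rw [inner_smul_left, orthonormal_iff_ite.1 (hon t ht), if_pos rfl,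
        frenetMatrix_of_succ ν k t (l := l) hij]
      simp [l, mul_comm]
    · intro p _ hp
      rw [inner_smul_left, orthonormal_iff_ite.1 (hon t ht), if_neg hp, mul_zero]
    · simp

lemma contDiffOn_frenetMatrix {n : ℕ} {I : Set ℝ} {ν : ℝ → ℝ} {k : ℕ → ℝ → ℝ}
    (hν : ContDiffOn ℝ ∞ ν I) (hk : ∀ j : ℕ, 1 ≤ j → j ≤ n - 1 → ContDiffOn ℝ ∞ (k j) I)
    (i l : Fin n) : ContDiffOn ℝ ∞ (fun t => frenetMatrix ν k t i l) I := by
  simp only [frenetMatrix, Matrix.of_apply]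
  split_ifs
  · exact hν.mul (hk _ (by omega) (by omega))
  · exact (hν.mul (hk _ (by omega) (by omega))).neg
  · exact contDiffOn_const

lemma exists_hasSpeedAndCurvatures {n : ℕ} (hn : 2 ≤ n) {I : Set ℝ} (hI : I.OrdConnected)
    (hI' : UniqueDiffOn ℝ I) (hne : I.Nonempty) {ν : ℝ → ℝ} {k : ℕ → ℝ → ℝ}
    (hν : ContDiffOn ℝ ∞ ν I) (hk : ∀ j : ℕ, 1 ≤ j → j ≤ n - 1 → ContDiffOn ℝ ∞ (k j) I)
    (hν_pos : ∀ t ∈ I, 0 < ν t)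
    (hk_pos : ∀ j : ℕ, 1 ≤ j → j ≤ n - 2 → ∀ t ∈ I, 0 < k j t) :
    ∃ f : ℝ → EuclideanSpace ℝ (Fin n), HasSpeedAndCurvatures I f ν k := by
  obtain ⟨t₀, ht₀⟩ := hne
  have hK := contDiffOn_frenetMatrix hν hk
  have hskew : ∀ t ∈ I, ∀ i l : Fin n, frenetMatrix ν k t i l = -frenetMatrix ν k t l i :=
    fun t _ => frenetMatrix_skew ν k t
  obtain ⟨X, hX0, hX⟩ := exists_solvesFrameSystem hI hskew (fun i l => (hK i l).continuousOn) ht₀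
    fun i => EuclideanSpace.basisFun (Fin n) ℝ i
  have hX0' : (fun i => X i t₀) = fun i => EuclideanSpace.basisFun (Fin n) ℝ i := funext hX0
  have hon0 : Orthonormal ℝ fun i => X i t₀ := by
    rw [hX0']
    exact (EuclideanSpace.basisFun (Fin n) ℝ).orthonormal
  have hdet0 : (rowMatrix fun i => X i t₀).det = 1 := by
    rw [hX0', ← Matrix.det_one (n := Fin n)]
    congr 1
    ext i r
    simp [rowMatrix, Matrix.one_apply, eq_comm]
  let z : Fin n := ⟨0, by omega⟩
  have hg : ContDiffOn ℝ ∞ (fun t => ν t • X z t) I := hν.smul (hX.contDiffOn hI' hK z)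
  obtain ⟨f, hf⟩ := exists_hasDerivWithinAt_of_continuousOn hI ⟨t₀, ht₀⟩ hg.continuousOn
  have hf' : ∀ t ∈ I, derivWithin f I t = ν t • X z t := fun t ht =>
    (hf t ht).derivWithin (hI' t ht)
  have hfs : ContDiffOn ℝ ∞ f I := (contDiffOn_infty_iff_derivWithin hI').2
    ⟨fun t ht => (hf t ht).differentiableWithinAt, hg.congr hf'⟩
  exact ⟨f, hasSpeedAndCurvatures_of_frame hI' hν_pos hk_pos hX
    (fun t ht => hX.orthonormal hI hskew ht₀ hon0 ht)
    (fun t ht => hX.det_eq_one hI hskew ht₀ hon0 hdet0 ht) hfs z rfl hf'⟩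

end FrenetCurve

theorem mainTheorem1 (n : ℕ) (hn : 2 ≤ n) (I : Set ℝ) (hI : I.OrdConnected) (hI' : I.Nontrivial)
    (ν : ℝ → ℝ) (k : ℕ → ℝ → ℝ)
    (hν : ContDiffOn ℝ ∞ ν I) (hk : ∀ j : ℕ, 1 ≤ j → j ≤ n - 1 → ContDiffOn ℝ ∞ (k j) I)
    (hν_pos : ∀ t ∈ I, 0 < ν t)
    (hk_pos : ∀ j : ℕ, 1 ≤ j → j ≤ n - 2 → ∀ t ∈ I, 0 < k j t) :
    (∃ f : ℝ → EuclideanSpace ℝ (Fin n), FrenetCurve.HasSpeedAndCurvatures I f ν k) ∧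
    ∀ f g : ℝ → EuclideanSpace ℝ (Fin n),
      FrenetCurve.HasSpeedAndCurvatures I f ν k → FrenetCurve.HasSpeedAndCurvatures I g ν k →
      ∃ F : EuclideanSpace ℝ (Fin n) ≃ᵃⁱ[ℝ] EuclideanSpace ℝ (Fin n),
        FrenetCurve.OrientationPreserving F ∧ ∀ t ∈ I, g t = F (f t) := by
  have hU : UniqueDiffOn ℝ I :=
    uniqueDiffOn_convex hI.convex (hI.convex.nontrivial_iff_nonempty_interior.1 hI')
  exact ⟨FrenetCurve.exists_hasSpeedAndCurvatures hn hI hU hI'.nonempty hν hk hν_pos hk_pos,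
    fun f g hf hg => FrenetCurve.exists_isometry_of_hasSpeedAndCurvatures hn hI hU hI'.nonempty
      (fun t ht => (hν_pos t ht).ne') hf hg⟩
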